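/- Let $G$ be a real reductive Lie group with Cartan decomposition $G=K\exp(\mathfrak p)$. That is: $G$ is a real Lie group with finitely many connected components whose Lie algebra is $\mathfrak g=[\mathfrak g,\mathfrak g]\oplus\mathfrak z(\mathfrak g)$ with $[\mathfrak g,\mathfrak g]$ semisimple; $\theta:G\to G$ is a smooth involutive automorphism whose fixed point group $K$ is compact; $\mathfrak g=\mathfrak k\oplus\mathfrak p$ is the decomposition into the $(+1)$- and $(-1)$-eigenspaces of $d\theta$, so that $\mathfrak k$ is the Lie algebra of $K$; and $K\times\mathfrak p\to G$, $(k,v)\mapsto k\exp(v)$, is a homeomorphism (for the usual Cartan decomposition it is even a diffeomorphism; it follows that $K$ is a maximal compact subgroup). Let $\mathscr M$ be a Hausdorff topological space with a continuous action of $G$; write $G_x$ for the stabilizer of $x\in\mathscr M$ and $\mathfrak g_x=\{v\in\mathfrak g:\exp(\mathbb R v)\subset G_x\}$ for its Lie algebra. Let $\Psi:\mathscr M\times G\to\mathbb R$ be a Kempf–Ness function, i.e. a function such that - (P1) for every $x\in\mathscr M$ the function $\Psi(x,\cdot)$ is smooth on $G$; - (P2) $\Psi(x,kg)=\Psi(x,g)$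 for all $x\in\mathscr M$, $k\in K$, $g\in G$; - (P3) for all $x\in\mathscr M$, $v\in\mathfrak p$ and $t\in\mathbb R$ one has $\frac{d^2}{dt^2}\Psi(x,\exp(tv))\ge 0$, and $\frac{d^2}{dt^2}\big|_{t=0}\Psi(x,\exp(tv))=0$ if and only if $\exp(\mathbb R v)\subset G_x$; - (P4) $\Psi(x,g)+\Psi(gx,h)=\Psi(x,hg)$ for all $x\in\mathscr M$ and $g,h\in G$; - (P5) the gradient map $\mathfrak F:\mathscr M\to\mathfrak p^*$, defined by $\langle\mathfrak F(x),v\rangle=\frac{d}{dt}\big|_{t=0}\Psi(x,\exp(tv))$ for $v\in\mathfrak p$, is continuous. For $x\in\mathscr M$ and $\xi\in\mathfrak p$ put $\Lambda(x,\xi)=\lim_{t\to+\infty}\frac{d}{dt}\Psi(x,\exp(t\xi))\in[-\infty,+\infty]$; the limit exists because the derivative is nondecreasing in $t$ by (P3). A point $x\in\mathscr M$ is called stable if $Gx\cap\mathfrak F^{-1}(0)\neq\emptyset$ and $\mathfrak g_x$ is conjugate to a subalgebra of $\mathfrak k$, i.e. $\mathrm{Ad}(g)(\mathfrak g_x)\subset\mathfrak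 k$ for some $g\in G$. **Theorem.** A point $x\in\mathscr M$ is stable if and only if $\Lambda(x,\xi)>0$ for every $\xi\in\mathfrak p\setminus\{0\}$. -/

import Mathlib

open scoped Manifold ContDiff Topology

set_option linter.unusedSectionVars false

namespace RealReductive
/-- Makes the Lie bracket of Mathlib available on the Lie algebra of a smooth real Lie group. -/
instance leInfty_minSmoothness : ENat.LEInfty (minSmoothness ℝ 3) :=
  ⟨by rw [minSmoothness_of_isRCLikeNormedField]; exact ENat.LEInfty.out⟩
section
variable {E : Type*} [NormedAddCommGroup E] [NormedSpace ℝ E] [FiniteDimensional ℝ E]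
  {G : Type*} [TopologicalSpace G] [ChartedSpace E G] [Group G] [LieGroup 𝓘(ℝ, E) ∞ G]


theorem contMDiff_invariantField (v : GroupLieAlgebra 𝓘(ℝ, E) G) :
    ContMDiff 𝓘(ℝ, E) 𝓘(ℝ, E).tangent 1
      (fun g : G ↦ (⟨g, mulInvariantVectorField v g⟩ : TangentBundle 𝓘(ℝ, E) G)) :=
  (contMDiff_mulInvariantVectorField v).of_le (le_trans (by norm_num) le_minSmoothness)

theorem mulInvariantVectorField_mul_aux (v : GroupLieAlgebra 𝓘(ℝ, E) G) (g h k : G) (hk : k = h * 1) :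
    mfderiv 𝓘(ℝ, E) 𝓘(ℝ, E) (g * ·) k (mfderiv 𝓘(ℝ, E) 𝓘(ℝ, E) (h * ·) 1 v) =
      mfderiv 𝓘(ℝ, E) 𝓘(ℝ, E) (g * h * ·) 1 v := by
  subst hk
  have hd : ∀ a b : G, MDifferentiableAt 𝓘(ℝ, E) 𝓘(ℝ, E) (a * ·) b := fun a b ↦
    (contMDiff_mul_left (I := 𝓘(ℝ, E)) (n := ∞) (a := a)).contMDiffAt.mdifferentiableAt (by simp)
  have D : (fun x : G ↦ g * h * x) = (fun x ↦ g * x) ∘ (fun x ↦ h * x) := by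
    ext x; simp [mul_assoc]
  rw [D, mfderiv_comp (I' := 𝓘(ℝ, E)) (1 : G) (hd g (h * 1)) (hd h 1)]
  rfl

theorem mulInvariantVectorField_mul (v : GroupLieAlgebra 𝓘(ℝ, E) G) (g h : G) :
    mfderiv 𝓘(ℝ, E) 𝓘(ℝ, E) (g * ·) h (mulInvariantVectorField v h) =
      mulInvariantVectorField v (g * h) :=
  mulInvariantVectorField_mul_aux v g h h (mul_one h).symm

theorem isMIntegralCurveOn_mul_left {γ : ℝ → G} {s : Set ℝ} {v : GroupLieAlgebra 𝓘(ℝ, E) G}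
    (h : IsMIntegralCurveOn γ (mulInvariantVectorField (I := 𝓘(ℝ, E)) v) s) (g : G) :
    IsMIntegralCurveOn (fun t ↦ g * γ t) (mulInvariantVectorField (I := 𝓘(ℝ, E)) v) s := by
  intro t ht
  have hd : MDifferentiableAt 𝓘(ℝ, E) 𝓘(ℝ, E) (g * ·) (γ t) :=
    (contMDiff_mul_left (I := 𝓘(ℝ, E)) (n := ∞) (a := g)).contMDiffAt.mdifferentiableAt (by simp)
  have := hd.hasMFDerivAt.comp_hasMFDerivWithinAt t (h t ht)
  refine this.congr_mfderiv ?_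
  ext
  change mfderiv 𝓘(ℝ, E) 𝓘(ℝ, E) (g * ·) (γ t) ((1 : ℝ) • mulInvariantVectorField v (γ t)) =
    (1 : ℝ) • mulInvariantVectorField v (g * γ t)
  rw [one_smul, one_smul]
  exact mulInvariantVectorField_mul v g (γ t)

theorem exists_integralCurve_one [T2Space G] (v : GroupLieAlgebra 𝓘(ℝ, E) G) :
    ∃ γ : ℝ → G, γ 0 = 1 ∧ IsMIntegralCurve γ (mulInvariantVectorField (I := 𝓘(ℝ, E)) v) := by
  obtain ⟨γ, h0, hγ⟩ := exists_isMIntegralCurveAt_of_contMDiffAt_boundaryless (M := G) 0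
    (contMDiff_invariantField v).contMDiffAt (x₀ := 1)
  obtain ⟨ε, hε, hγ⟩ := isMIntegralCurveAt_iff'.1 hγ
  refine exists_isMIntegralCurve_of_isMIntegralCurveOn (contMDiff_invariantField v) hε (fun x ↦ ?_) 1
  refine ⟨fun t ↦ x * γ t, by simp [h0], ?_⟩
  rw [Real.ball_eq_Ioo] at hγ
  simpa using isMIntegralCurveOn_mul_left hγ x

theorem integralCurve_unique [T2Space G] (v : GroupLieAlgebra 𝓘(ℝ, E) G) {γ γ' : ℝ → G}
    (h : IsMIntegralCurve γ (mulInvariantVectorField (I := 𝓘(ℝ, E)) v))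
    (h' : IsMIntegralCurve γ' (mulInvariantVectorField (I := 𝓘(ℝ, E)) v)) (h0 : γ 0 = γ' 0) :
    γ = γ' :=
  isMIntegralCurve_Ioo_eq_of_contMDiff_boundaryless (contMDiff_invariantField v) h h' h0

/-- The exponential map of a Lie group: `lieExp v = γ 1`, where `γ` is the integral curve through `1`
of the left-invariant vector field determined by `v`. -/
noncomputable def lieExp [T2Space G] (v : GroupLieAlgebra 𝓘(ℝ, E) G) : G :=
  (exists_integralCurve_one v).choose 1

theorem isMIntegralCurve_lieExp [T2Space G] (v : GroupLieAlgebra 𝓘(ℝ, E) G) :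
    IsMIntegralCurve (fun t : ℝ ↦ lieExp (t • v)) (mulInvariantVectorField (I := 𝓘(ℝ, E)) v) := by
  obtain ⟨h0, hγ⟩ := (exists_integralCurve_one v).choose_spec
  set γ := (exists_integralCurve_one v).choose with hdef
  suffices h : (fun t : ℝ ↦ lieExp (t • v)) = γ by rw [h]; exact hγ
  funext t
  obtain ⟨k0, hk⟩ := (exists_integralCurve_one (t • v)).choose_spec
  have h1 := hγ.comp_mul t
  rw [← mulInvariantVectorField_smul] at h1
  have := integralCurve_unique (t • v) hk h1 (by simp [h0, k0])
  simpa [lieExp] using congrFun this 1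

theorem lieExp_zero [T2Space G] : lieExp (0 : GroupLieAlgebra 𝓘(ℝ, E) G) = 1 := by
  obtain ⟨h0, hγ⟩ := (exists_integralCurve_one (0 : GroupLieAlgebra 𝓘(ℝ, E) G)).choose_spec
  have h1 := hγ.comp_mul 0
  rw [← mulInvariantVectorField_smul, smul_zero] at h1
  have := integralCurve_unique 0 hγ h1 (by simp)
  have h2 := congrFun this 1
  simp only [Function.comp_apply, mul_zero, h0] at h2
  exact h2

theorem hasDerivAt_comp_lieExp [T2Space G] {f : G → ℝ} (hf : ContMDiff 𝓘(ℝ, E) 𝓘(ℝ, ℝ) ∞ f)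
    (v : GroupLieAlgebra 𝓘(ℝ, E) G) (t : ℝ) :
    HasDerivAt (fun s : ℝ ↦ f (lieExp (s • v)))
      (mfderiv 𝓘(ℝ, E) 𝓘(ℝ, ℝ) f (lieExp (t • v)) (mulInvariantVectorField v (lieExp (t • v)))) t := by
  have h1 := ((hf.mdifferentiable (by simp)) (lieExp (t • v))).hasMFDerivAt.comp t (isMIntegralCurve_lieExp v t)
  have h2 : HasFDerivAt (𝕜 := ℝ) (E := ℝ) (F := ℝ) (fun s : ℝ ↦ f (lieExp (s • v))) _ t :=
    h1.hasFDerivAt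
  refine h2.hasDerivAt.congr_deriv ?_
  change mfderiv 𝓘(ℝ, E) 𝓘(ℝ, ℝ) f (lieExp (t • v))
    ((1 : ℝ) • mulInvariantVectorField v (lieExp (t • v))) = _
  rw [one_smul]

theorem contMDiff_field_apply {f : G → ℝ} (hf : ContMDiff 𝓘(ℝ, E) 𝓘(ℝ, ℝ) ∞ f)
    (v : GroupLieAlgebra 𝓘(ℝ, E) G) :
    ContMDiff 𝓘(ℝ, E) 𝓘(ℝ, ℝ) 1
      (fun g : G ↦ (mfderiv 𝓘(ℝ, E) 𝓘(ℝ, ℝ) f g (mulInvariantVectorField v g) : ℝ)) := by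
  have h1 : ContMDiff 𝓘(ℝ, E).tangent 𝓘(ℝ, ℝ).tangent 1 (tangentMap 𝓘(ℝ, E) 𝓘(ℝ, ℝ) f) :=
    hf.contMDiff_tangentMap (by norm_num; exact ENat.LEInfty.out)
  exact (contMDiff_snd_tangentBundle_modelSpace ℝ 𝓘(ℝ, ℝ)).comp (h1.comp (contMDiff_invariantField v))

theorem differentiable_deriv_comp_lieExp [T2Space G] {f : G → ℝ}
    (hf : ContMDiff 𝓘(ℝ, E) 𝓘(ℝ, ℝ) ∞ f) (v : GroupLieAlgebra 𝓘(ℝ, E) G) :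
    Differentiable ℝ (deriv fun s : ℝ ↦ f (lieExp (s • v))) := by
  have h : (deriv fun s : ℝ ↦ f (lieExp (s • v))) = _ :=
    funext fun t ↦ (hasDerivAt_comp_lieExp hf v t).deriv
  rw [h]
  intro t
  have h1 := (((contMDiff_field_apply hf v).mdifferentiable (by simp))
    (lieExp (t • v))).hasMFDerivAt.comp t (isMIntegralCurve_lieExp v t)
  exact h1.hasFDerivAt.differentiableAt

theorem mulInvariantVectorField_one (v : GroupLieAlgebra 𝓘(ℝ, E) G) :
    mulInvariantVectorField v 1 = v := by
  have h : (fun x : G ↦ 1 * x) = id := by ext x; simp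
  rw [mulInvariantVectorField, h, mfderiv_id]
  rfl

/-- The Lie algebra of a closed subgroup `H` of `G`, as a subset of the Lie algebra of `G`: the
vectors `v` with `exp (ℝ v) ⊆ H`. -/
def subgroupLieAlgebra (E : Type*) [NormedAddCommGroup E] [NormedSpace ℝ E] [FiniteDimensional ℝ E]
    {G : Type*} [TopologicalSpace G] [ChartedSpace E G] [Group G] [LieGroup 𝓘(ℝ, E) ∞ G] [T2Space G]
    (H : Subgroup G) : Set (GroupLieAlgebra 𝓘(ℝ, E) G) :=
  {v | ∀ t : ℝ, lieExp (t • v) ∈ H}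

/-- The differential at `1` of a group automorphism. -/
noncomputable def autDifferential (E : Type*) [NormedAddCommGroup E] [NormedSpace ℝ E]
    {G : Type*} [TopologicalSpace G] [ChartedSpace E G] [Group G] (φ : G ≃* G) :
    GroupLieAlgebra 𝓘(ℝ, E) G →L[ℝ] GroupLieAlgebra 𝓘(ℝ, E) G :=
  mfderiv 𝓘(ℝ, E) 𝓘(ℝ, E) (fun h : G ↦ φ h) 1

/-- The adjoint action `Ad g` on the Lie algebra: the differential at `1` of `h ↦ g * h * g⁻¹`. -/
noncomputable def adjoint (E : Type*) [NormedAddCommGroup E] [NormedSpace ℝ E]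
    {G : Type*} [TopologicalSpace G] [ChartedSpace E G] [Group G] (g : G) :
    GroupLieAlgebra 𝓘(ℝ, E) G →L[ℝ] GroupLieAlgebra 𝓘(ℝ, E) G :=
  autDifferential E (MulAut.conj g)

/-- The subspace `𝔭`: the `-1` eigenspace of the differential of `θ`. -/
noncomputable def cartanP (E : Type*) [NormedAddCommGroup E] [NormedSpace ℝ E]
    {G : Type*} [TopologicalSpace G] [ChartedSpace E G] [Group G] (θ : G ≃* G) :
    Submodule ℝ (GroupLieAlgebra 𝓘(ℝ, E) G) :=
  Module.End.eigenspace (autDifferential E θ : GroupLieAlgebra 𝓘(ℝ, E) G →ₗ[ℝ] _) (-1)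

theorem mem_cartanP (θ : G ≃* G) (v : GroupLieAlgebra 𝓘(ℝ, E) G) :
    v ∈ cartanP E θ ↔ autDifferential E θ v = -v := by
  simp [cartanP]

/-- A real Lie algebra is reductive if it is the direct sum of its derived algebra and its center
and the derived algebra is semisimple. -/
structure IsReductiveLieAlgebra (L : Type*) [LieRing L] [LieAlgebra ℝ L] : Prop where
  isCompl : IsCompl (⁅(⊤ : LieIdeal ℝ L), (⊤ : LieIdeal ℝ L)⁆ : LieIdeal ℝ L) (LieAlgebra.center ℝ L)
  isSemisimple : LieAlgebra.IsSemisimple ℝ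
    (⁅(⊤ : LieIdeal ℝ L), (⊤ : LieIdeal ℝ L)⁆ : LieIdeal ℝ L)

/-- `G` is a real reductive Lie group with Cartan involution `θ` and maximal compact subgroup `K`:
it has finitely many components and a reductive Lie algebra, `θ` is a smooth involutive automorphism
whose fixed point group is the compact group `K`, and `(k, v) ↦ k * exp v` identifies `K × 𝔭` with
`G` (Cartan decomposition). It is enough to ask for a homeomorphism here instead of a
diffeomorphism. That `K` is a maximal compact subgroup follows: a larger compact subgroup would
contain `exp (n v)` for all integers `n` and some nonzero `v` in `𝔭`. -/
structure IsRealReductive (E : Type*) [NormedAddCommGroup E] [NormedSpace ℝ E]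
    [FiniteDimensional ℝ E] {G : Type*} [TopologicalSpace G] [ChartedSpace E G] [Group G]
    [LieGroup 𝓘(ℝ, E) ∞ G] [T2Space G] (θ : G ≃* G) (K : Subgroup G) : Prop where
  finite_components : Finite (ConnectedComponents G)
  reductive : IsReductiveLieAlgebra (GroupLieAlgebra 𝓘(ℝ, E) G)
  smooth : ContMDiff 𝓘(ℝ, E) 𝓘(ℝ, E) ∞ (fun g : G ↦ θ g)
  involutive : ∀ g : G, θ (θ g) = g
  mem_iff : ∀ g : G, g ∈ K ↔ θ g = g
  compact : IsCompact (K : Set G)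
  decomposition : IsHomeomorph (fun q : K × cartanP E θ ↦
    (q.1 : G) * lieExp (q.2 : GroupLieAlgebra 𝓘(ℝ, E) G))

/-- The gradient map `𝔉 : M → 𝔭*`: the differential at `1` of `Ψ (x, ·)`, restricted to `𝔭`. -/
noncomputable def gradientMap (E : Type*) [NormedAddCommGroup E] [NormedSpace ℝ E]
    {G : Type*} [TopologicalSpace G] [ChartedSpace E G] [Group G] (θ : G ≃* G)
    {M : Type*} (Ψ : M → G → ℝ) (x : M) : StrongDual ℝ (cartanP E θ) :=
  (mfderiv 𝓘(ℝ, E) 𝓘(ℝ, ℝ) (Ψ x) 1 : GroupLieAlgebra 𝓘(ℝ, E) G →L[ℝ] ℝ).comp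
    (cartanP E θ).subtypeL

/-- `⟨𝔉 x, v⟩` is the derivative at `t = 0` of `Ψ (x, exp (t v))`. -/
theorem hasDerivAt_gradientMap [T2Space G] (θ : G ≃* G) {M : Type*} (Ψ : M → G → ℝ) (x : M)
    (hΨ : ContMDiff 𝓘(ℝ, E) 𝓘(ℝ, ℝ) ∞ (Ψ x)) (v : cartanP E θ) :
    HasDerivAt (fun t : ℝ ↦ Ψ x (lieExp (t • (v : GroupLieAlgebra 𝓘(ℝ, E) G))))
      (gradientMap E θ Ψ x v) 0 := by
  have h := hasDerivAt_comp_lieExp hΨ (v : GroupLieAlgebra 𝓘(ℝ, E) G) 0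
  rw [zero_smul, lieExp_zero, mulInvariantVectorField_one] at h
  exact h

/-- Kempf--Ness functions. -/
structure IsKempfNess (E : Type*) [NormedAddCommGroup E] [NormedSpace ℝ E] [FiniteDimensional ℝ E]
    {G : Type*} [TopologicalSpace G] [ChartedSpace E G] [Group G] [LieGroup 𝓘(ℝ, E) ∞ G] [T2Space G]
    (θ : G ≃* G) (K : Subgroup G) {M : Type*} [TopologicalSpace M] [MulAction G M]
    (Ψ : M → G → ℝ) : Prop where
  smooth : ∀ x : M, ContMDiff 𝓘(ℝ, E) 𝓘(ℝ, ℝ) ∞ (Ψ x)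
  left_invariant : ∀ (x : M) (k g : G), k ∈ K → Ψ x (k * g) = Ψ x g
  convex : ∀ x : M, ∀ v ∈ cartanP E θ, ∀ t : ℝ,
    0 ≤ iteratedDeriv 2 (fun s : ℝ ↦ Ψ x (lieExp (s • v))) t
  degenerate_iff : ∀ x : M, ∀ v ∈ cartanP E θ,
    iteratedDeriv 2 (fun s : ℝ ↦ Ψ x (lieExp (s • v))) 0 = 0 ↔
      ∀ t : ℝ, lieExp (t • v) ∈ MulAction.stabilizer G x
  cocycle : ∀ (x : M) (g h : G), Ψ x g + Ψ (g • x) h = Ψ x (h * g)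
  continuous_gradientMap : Continuous (gradientMap E θ Ψ)

/-- `x` is polystable if its orbit meets the zero set of the gradient map. -/
def IsPolystable (E : Type*) [NormedAddCommGroup E] [NormedSpace ℝ E]
    {G : Type*} [TopologicalSpace G] [ChartedSpace E G] [Group G] (θ : G ≃* G)
    {M : Type*} [MulAction G M] (Ψ : M → G → ℝ) (x : M) : Prop :=
  (MulAction.orbit G x ∩ gradientMap E θ Ψ ⁻¹' {0}).Nonempty

/-- `x` is stable if it is polystable and `Ad g` maps the Lie algebra of its stabilizer into the Lie
algebra of `K`, for some `g`. -/
def IsStable (E : Type*) [NormedAddCommGroup E] [NormedSpace ℝ E] [FiniteDimensional ℝ E]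
    {G : Type*} [TopologicalSpace G] [ChartedSpace E G] [Group G] [LieGroup 𝓘(ℝ, E) ∞ G] [T2Space G]
    (θ : G ≃* G) (K : Subgroup G) {M : Type*} [MulAction G M] (Ψ : M → G → ℝ) (x : M) : Prop :=
  IsPolystable E θ Ψ x ∧ ∃ g : G,
    adjoint E g '' subgroupLieAlgebra E (MulAction.stabilizer G x) ⊆ subgroupLieAlgebra E K

/-- `Λ (x, ξ)`: the limit in `[-∞, ∞]` of the derivative of `Ψ (x, exp (t ξ))` as `t → ∞`. -/
noncomputable def maximalWeight {E : Type*} [NormedAddCommGroup E] [NormedSpace ℝ E]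
    [FiniteDimensional ℝ E] {G : Type*} [TopologicalSpace G] [ChartedSpace E G] [Group G]
    [LieGroup 𝓘(ℝ, E) ∞ G] [T2Space G] {M : Type*} (Ψ : M → G → ℝ) (x : M)
    (ξ : GroupLieAlgebra 𝓘(ℝ, E) G) : EReal :=
  Filter.limUnder Filter.atTop
    (fun t : ℝ ↦ ((deriv (fun s : ℝ ↦ Ψ x (lieExp (s • ξ))) t : ℝ) : EReal))

/-- For a Kempf--Ness function the limit that defines `Λ (x, ξ)` exists. -/
theorem IsKempfNess.tendsto_maximalWeight [T2Space G] {θ : G ≃* G} {K : Subgroup G} {M : Type*}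
    [TopologicalSpace M] [MulAction G M] {Ψ : M → G → ℝ} (hΨ : IsKempfNess E θ K Ψ) (x : M)
    {ξ : GroupLieAlgebra 𝓘(ℝ, E) G} (hξ : ξ ∈ cartanP E θ) :
    Filter.Tendsto (fun t : ℝ ↦ ((deriv (fun s : ℝ ↦ Ψ x (lieExp (s • ξ))) t : ℝ) : EReal))
      Filter.atTop (𝓝 (maximalWeight Ψ x ξ)) := by
  have hmono : Monotone (deriv (fun s : ℝ ↦ Ψ x (lieExp (s • ξ)))) := by
    refine monotone_of_deriv_nonneg (differentiable_deriv_comp_lieExp (hΨ.smooth x) ξ) fun t ↦ ?_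
    have := hΨ.convex x ξ hξ t
    rwa [iteratedDeriv_succ, iteratedDeriv_one] at this
  exact tendsto_nhds_limUnder
    ⟨_, tendsto_atTop_iSup fun a b hab ↦ EReal.coe_le_coe_iff.2 (hmono hab)⟩

end

end RealReductive

/-!
For a Kempf--Ness function `Ψ` the numerical condition "`Λ (x, ξ) > 0` for all nonzero `ξ ∈ 𝔭`" is
equivalent to properness: `Ψ x → ∞` at infinity on `G`
(`IsKempfNess.maximalWeight_pos_iff_tendsto_cocompact`).
Indeed, by left `K`-invariance and the Cartan decomposition, `Ψ x` is proper on `G` if and only if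
`v ↦ Ψ x (exp v)` is proper on `𝔭`. This function is convex along lines through `0` and vanishes at
`0`, so `Λ (x, ξ) > 0` says that it takes a positive value somewhere on the ray through `ξ`, and
compactness of the unit sphere makes this uniform in `ξ`
(`tendsto_cocompact_atTop_of_convexOn_lines`). By the cocycle identity, `Ψ (g • x)` is, up to an
additive constant, a right translate of `Ψ x`, so properness depends only on the orbit of `x`.

If `Ψ x` is proper, it attains its minimum at some `g`, and `y = g • x` is a zero of the gradient
map. On the stabilizer of `y` the function `Ψ y` is additive and nonnegative, so it vanishes there.
If `k * exp w` fixes `y`, then `t ↦ Ψ y (exp (t w))` is convex, nonnegative and vanishes at `0` and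
`1`, so its second derivative at `0` is zero and `exp (ℝ w)` fixes `y`; properness forces `w = 0`.
So the stabilizer of `y` is contained in `K`, and `Ad g` takes the Lie algebra of the stabilizer of
`x` into `𝔨`.

Conversely, suppose that `y = g • x` is a zero of the gradient map and that the Lie algebra of the
stabilizer of `x` is conjugate into `𝔨`. If `exp (ℝ v)` fixes `y` for some `v ∈ 𝔭`, then it lies in a
conjugate of the compact group `K`, so `v = 0`. So for nonzero `v` the convex function
`t ↦ Ψ y (exp (t v))` has zero derivative and positive second derivative at `0`; hence it is positive
somewhere, which makes `Ψ y`, and with it `Ψ x`, proper.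
-/

open Filter Set

namespace RealReductive

/-! ### Functions convex along lines through the origin -/

theorem mul_le_of_convexOn_of_zero {φ : ℝ → ℝ} (hφ : ConvexOn ℝ univ φ) (h0 : φ 0 = 0) {t c : ℝ}
    (hc : 1 ≤ c) : c * φ t ≤ φ (c * t) := by
  have hc0 : 0 < c := by linarith
  have h := hφ.2 (mem_univ 0) (mem_univ (c * t))
    (sub_nonneg.2 (inv_le_one_of_one_le₀ hc)) (inv_nonneg.2 hc0.le) (by ring)
  simp only [smul_eq_mul, mul_zero, zero_add, h0, inv_mul_cancel_left₀ hc0.ne'] at h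
  rwa [le_inv_mul_iff₀ hc0] at h

theorem tendsto_cocompact_atTop_of_convexOn_lines_aux {V : Type*} [NormedAddCommGroup V]
    [NormedSpace ℝ V] [FiniteDimensional ℝ V] {F : V → ℝ} (hF : Continuous F) (h0 : F 0 = 0)
    (hconv : ∀ v : V, ConvexOn ℝ univ fun t : ℝ ↦ F (t • v))
    (hpos : ∀ v : V, v ≠ 0 → ∃ t : ℝ, 0 < t ∧ 0 < F (t • v)) :
    Tendsto F (cocompact V) atTop := by
  have : ProperSpace V := FiniteDimensional.proper ℝ V
  have hmul : ∀ (v : V) (c : ℝ), 1 ≤ c → c * F v ≤ F (c • v) := fun v c hc ↦ by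
    simpa using mul_le_of_convexOn_of_zero (hconv v) (by simpa using h0) (t := 1) hc
  -- On each ray positivity persists, so by compactness one radius `T` serves all directions.
  obtain ⟨⟨T, hT⟩, hST⟩ := (isCompact_sphere (0 : V) 1).elim_directed_cover
    (fun t : {t : ℝ // 0 < t} ↦ {v : V | 0 < F (t.1 • v)})
    (fun t ↦ isOpen_lt continuous_const (hF.comp (continuous_const_smul _)))
    (fun v hv ↦ by
      obtain ⟨t, ht, h⟩ := hpos v (by rintro rfl; simp at hv)
      exact mem_iUnion.2 ⟨⟨t, ht⟩, h⟩)
    (directed_of_isDirected_le fun s t hst v (hv : 0 < F (s.1 • v)) ↦ by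
      have h1 : 1 ≤ t.1 / s.1 := (one_le_div s.2).2 hst
      have h := hmul (s.1 • v) _ h1
      rw [smul_smul, div_mul_cancel₀ _ s.2.ne'] at h
      exact (mul_pos (by linarith) hv).trans_le h)
  obtain ⟨m, hm, hmS⟩ := (isCompact_sphere (0 : V) 1).exists_forall_le'
    (hF.comp (continuous_const_smul T)).continuousOn hST
  have hlin : Tendsto (fun v : V ↦ ‖v‖ / T * m) (cocompact V) atTop :=
    ((tendsto_norm_cocompact_atTop (E := V)).atTop_div_const hT).atTop_mul_const hm
  refine tendsto_atTop_mono' _ ?_ hlin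
  filter_upwards [(tendsto_norm_cocompact_atTop (E := V)).eventually_ge_atTop T] with v hv
  have hv0 : 0 < ‖v‖ := hT.trans_le hv
  have h1 : 1 ≤ ‖v‖ / T := (one_le_div hT).2 hv
  have h := hmul (T • ‖v‖⁻¹ • v) _ h1
  rw [smul_smul (‖v‖ / T), div_mul_cancel₀ _ hT.ne', smul_inv_smul₀ hv0.ne'] at h
  refine le_trans ?_ h
  gcongr
  exact hmS (‖v‖⁻¹ • v) (by simp [norm_smul, hv0.ne'])

/-- On a finite-dimensional space, a continuous function that vanishes at the origin, is convex along
lines through it and is positive somewhere on each ray tends to infinity at infinity. -/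
theorem tendsto_cocompact_atTop_of_convexOn_lines {V : Type*} [AddCommGroup V] [Module ℝ V]
    [TopologicalSpace V] [IsTopologicalAddGroup V] [ContinuousSMul ℝ V] [T2Space V]
    [FiniteDimensional ℝ V] {F : V → ℝ} (hF : Continuous F) (h0 : F 0 = 0)
    (hconv : ∀ v : V, ConvexOn ℝ univ fun t : ℝ ↦ F (t • v))
    (hpos : ∀ v : V, v ≠ 0 → ∃ t : ℝ, 0 < t ∧ 0 < F (t • v)) :
    Tendsto F (cocompact V) atTop := by
  let L : V ≃L[ℝ] EuclideanSpace ℝ (Fin (Module.finrank ℝ V)) := toEuclidean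
  have h := tendsto_cocompact_atTop_of_convexOn_lines_aux (F := F ∘ L.symm)
    (hF.comp L.symm.continuous) (by simpa using h0) (fun v ↦ by simpa using hconv (L.symm v))
    (fun v hv ↦ by simpa using hpos (L.symm v) (by simpa using hv))
  have h' := h.comp L.toHomeomorph.isClosedEmbedding.tendsto_cocompact
  refine h'.congr fun v ↦ ?_
  simp

section
variable {E : Type*} [NormedAddCommGroup E] [NormedSpace ℝ E] [FiniteDimensional ℝ E]
  {G : Type*} [TopologicalSpace G] [T2Space G] [ChartedSpace E G] [Group G] [LieGroup 𝓘(ℝ, E) ∞ G]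
  {θ : G ≃* G} {K : Subgroup G}

/-! ### The adjoint action and the exponential map -/

theorem mfderiv_conj_mulInvariantVectorField (g h : G) (v : GroupLieAlgebra 𝓘(ℝ, E) G) :
    mfderiv 𝓘(ℝ, E) 𝓘(ℝ, E) (fun a : G ↦ g * a * g⁻¹) h (mulInvariantVectorField v h) =
      mulInvariantVectorField (adjoint E g v) (g * h * g⁻¹) := by
  have hl : ∀ a b : G, MDifferentiableAt 𝓘(ℝ, E) 𝓘(ℝ, E) (a * ·) b := fun a b ↦
    (contMDiff_mul_left (I := 𝓘(ℝ, E)) (n := ∞) (a := a)).contMDiffAt.mdifferentiableAt (by simp)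
  have hr : ∀ a b : G, MDifferentiableAt 𝓘(ℝ, E) 𝓘(ℝ, E) (· * a) b := fun a b ↦
    (contMDiff_mul_right (I := 𝓘(ℝ, E)) (n := ∞) (a := a)).contMDiffAt.mdifferentiableAt (by simp)
  have hc : ∀ b : G, MDifferentiableAt 𝓘(ℝ, E) 𝓘(ℝ, E) (fun a : G ↦ g * a * g⁻¹) b := fun b ↦
    (hr g⁻¹ (g * b)).comp b (hl g b)
  -- Both sides are the differential at `1` of `a ↦ g * h * a * g⁻¹`.
  have hcomp : (fun a : G ↦ g * a * g⁻¹) ∘ (fun a ↦ h * a) =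
      (fun a ↦ g * h * g⁻¹ * a) ∘ (fun a ↦ g * a * g⁻¹) := by
    ext a; simp [mul_assoc]
  have key : ∀ p q : G, p = h * 1 → q = g * 1 * g⁻¹ →
      mfderiv 𝓘(ℝ, E) 𝓘(ℝ, E) (fun a : G ↦ g * a * g⁻¹) p
        (mfderiv 𝓘(ℝ, E) 𝓘(ℝ, E) (h * ·) 1 v) =
      mfderiv 𝓘(ℝ, E) 𝓘(ℝ, E) (g * h * g⁻¹ * ·) q
        (mfderiv 𝓘(ℝ, E) 𝓘(ℝ, E) (fun a : G ↦ g * a * g⁻¹) 1 v) := by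
    rintro _ _ rfl rfl
    have h1 := mfderiv_comp (I' := 𝓘(ℝ, E)) (1 : G) (hc (h * 1)) (hl h 1)
    have h2 := mfderiv_comp (I' := 𝓘(ℝ, E)) (1 : G) (hl (g * h * g⁻¹) (g * 1 * g⁻¹)) (hc 1)
    rw [hcomp] at h1
    exact (DFunLike.congr_fun h1 v).symm.trans (DFunLike.congr_fun h2 v)
  exact key h 1 (mul_one h).symm (by simp)

theorem lieExp_smul_adjoint (g : G) (v : GroupLieAlgebra 𝓘(ℝ, E) G) (t : ℝ) :
    lieExp (t • adjoint E g v) = g * lieExp (t • v) * g⁻¹ := by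
  have hc : ContMDiff 𝓘(ℝ, E) 𝓘(ℝ, E) ∞ (fun a : G ↦ g * a * g⁻¹) :=
    (contMDiff_const.mul contMDiff_id).mul contMDiff_const
  have hcurve : IsMIntegralCurve (fun t : ℝ ↦ g * lieExp (t • v) * g⁻¹)
      (mulInvariantVectorField (I := 𝓘(ℝ, E)) (adjoint E g v)) := by
    intro t
    have := (hc.mdifferentiable (by simp) (lieExp (t • v))).hasMFDerivAt.comp t
      (isMIntegralCurve_lieExp v t)
    refine this.congr_mfderiv ?_
    ext
    change mfderiv 𝓘(ℝ, E) 𝓘(ℝ, E) (fun a : G ↦ g * a * g⁻¹) (lieExp (t • v))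
        ((1 : ℝ) • mulInvariantVectorField v (lieExp (t • v))) =
      (1 : ℝ) • mulInvariantVectorField (adjoint E g v) (g * lieExp (t • v) * g⁻¹)
    rw [one_smul, one_smul]
    exact mfderiv_conj_mulInvariantVectorField g _ v
  exact congrFun (integralCurve_unique _ (isMIntegralCurve_lieExp (adjoint E g v)) hcurve
    (by simp [lieExp_zero])) t

/-! ### The Cartan decomposition -/

theorem finiteDimensional_cartanP : FiniteDimensional ℝ (cartanP E θ) :=
  have : FiniteDimensional ℝ (GroupLieAlgebra 𝓘(ℝ, E) G) := inferInstanceAs (FiniteDimensional ℝ E)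
  inferInstance

theorem t2Space_cartanP : T2Space (cartanP E θ) :=
  have : T2Space (GroupLieAlgebra 𝓘(ℝ, E) G) := inferInstanceAs (T2Space E)
  inferInstance

theorem IsRealReductive.isClosedEmbedding_lieExp (hG : IsRealReductive E θ K) :
    Topology.IsClosedEmbedding
      (fun v : cartanP E θ ↦ lieExp (v : GroupLieAlgebra 𝓘(ℝ, E) G)) := by
  have := t2Space_cartanP (E := E) (θ := θ)
  have hinv : Function.LeftInverse Prod.snd fun v : cartanP E θ ↦ ((1 : K), v) := fun _ ↦ rfl
  have h := hG.decomposition.isClosedEmbedding.comp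
    (hinv.isClosedEmbedding continuous_snd (by fun_prop))
  simpa [Function.comp_def] using h

theorem IsRealReductive.exists_eq_mul_lieExp (hG : IsRealReductive E θ K) (g : G) :
    ∃ k ∈ K, ∃ v : cartanP E θ, g = k * lieExp (v : GroupLieAlgebra 𝓘(ℝ, E) G) := by
  obtain ⟨⟨k, v⟩, h⟩ := hG.decomposition.surjective g
  exact ⟨k, k.2, v, h.symm⟩

theorem IsRealReductive.tendsto_lieExp_smul (hG : IsRealReductive E θ K) {v : cartanP E θ}
    (hv : v ≠ 0) :
    Tendsto (fun t : ℝ ↦ lieExp (t • (v : GroupLieAlgebra 𝓘(ℝ, E) G))) atTop (cocompact G) := by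
  have := t2Space_cartanP (E := E) (θ := θ)
  have h : Tendsto (fun t : ℝ ↦ t • v) atTop (cocompact (cartanP E θ)) :=
    (isClosedEmbedding_smul_left hv).tendsto_cocompact.mono_left atTop_le_cocompact
  refine (hG.isClosedEmbedding_lieExp.tendsto_cocompact.comp h).congr fun t ↦ ?_
  rw [Function.comp_apply, Submodule.coe_smul]

/-- A one-parameter group in the direction of `𝔭` that stays in a conjugate of `K` is trivial. -/
theorem IsRealReductive.eq_zero_of_conj_lieExp_mem (hG : IsRealReductive E θ K) {v : cartanP E θ}
    (g : G) (h : ∀ t : ℝ, g * lieExp (t • (v : GroupLieAlgebra 𝓘(ℝ, E) G)) * g⁻¹ ∈ K) : v = 0 := by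
  by_contra hv
  have : ContinuousMul G := continuousMul_of_contMDiffMul 𝓘(ℝ, E) ∞
  have hcomp : IsCompact ((fun a : G ↦ g⁻¹ * a * g) '' (K : Set G)) :=
    hG.compact.image (by fun_prop)
  obtain ⟨t, ht⟩ := ((hG.tendsto_lieExp_smul hv).eventually hcomp.compl_mem_cocompact).exists
  exact ht ⟨_, h t, by simp [mul_assoc]⟩

/-- A left `K`-invariant function on `G` that is proper on `exp 𝔭` is proper on `G`. -/
theorem IsRealReductive.tendsto_cocompact_of_lieExp (hG : IsRealReductive E θ K) {f : G → ℝ}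
    (hf : ∀ k g : G, k ∈ K → f (k * g) = f g)
    (h : Tendsto (fun v : cartanP E θ ↦ f (lieExp (v : GroupLieAlgebra 𝓘(ℝ, E) G)))
      (cocompact (cartanP E θ)) atTop) : Tendsto f (cocompact G) atTop := by
  have : CompactSpace K := isCompact_iff_compactSpace.1 hG.compact
  let e := hG.decomposition.homeomorph
  have hsnd : Tendsto (Prod.snd : K × cartanP E θ → cartanP E θ) (cocompact _) (cocompact _) := by
    rw [← coprod_cocompact, Filter.coprod, cocompact_eq_bot]
    simpa using tendsto_comap
  have h1 := (h.comp hsnd).comp e.symm.isClosedEmbedding.tendsto_cocompact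
  refine h1.congr fun g ↦ ?_
  obtain ⟨q, rfl⟩ := e.surjective g
  simp only [Function.comp_apply, e.symm_apply_apply]
  exact (hf q.1 _ q.1.2).symm

/-! ### Kempf--Ness functions along one-parameter groups -/

variable {M : Type*} [TopologicalSpace M] [MulAction G M] {Ψ : M → G → ℝ}

theorem IsKempfNess.apply_one (hΨ : IsKempfNess E θ K Ψ) (x : M) : Ψ x 1 = 0 := by
  have := hΨ.cocycle x 1 1
  simp only [one_smul, mul_one] at this
  linarith

theorem IsKempfNess.differentiable_lieExp (hΨ : IsKempfNess E θ K Ψ) (x : M)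
    (v : GroupLieAlgebra 𝓘(ℝ, E) G) : Differentiable ℝ fun s : ℝ ↦ Ψ x (lieExp (s • v)) :=
  fun t ↦ (hasDerivAt_comp_lieExp (hΨ.smooth x) v t).differentiableAt

theorem IsKempfNess.monotone_deriv (hΨ : IsKempfNess E θ K Ψ) (x : M) (v : cartanP E θ) :
    Monotone (deriv fun s : ℝ ↦ Ψ x (lieExp (s • (v : GroupLieAlgebra 𝓘(ℝ, E) G)))) := by
  refine monotone_of_deriv_nonneg (differentiable_deriv_comp_lieExp (hΨ.smooth x) _) fun t ↦ ?_
  simpa [iteratedDeriv_succ] using hΨ.convex x v v.2 t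

theorem IsKempfNess.convexOn_lieExp (hΨ : IsKempfNess E θ K Ψ) (x : M) (v : cartanP E θ) :
    ConvexOn ℝ univ fun s : ℝ ↦ Ψ x (lieExp (s • (v : GroupLieAlgebra 𝓘(ℝ, E) G))) :=
  (hΨ.monotone_deriv x v).convexOn_univ_of_deriv (hΨ.differentiable_lieExp x _)

theorem IsKempfNess.maximalWeight_pos_iff (hΨ : IsKempfNess E θ K Ψ) (x : M) (v : cartanP E θ) :
    0 < maximalWeight Ψ x (v : GroupLieAlgebra 𝓘(ℝ, E) G) ↔
      ∃ t : ℝ, 0 < t ∧ 0 < Ψ x (lieExp (t • (v : GroupLieAlgebra 𝓘(ℝ, E) G))) := by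
  set φ : ℝ → ℝ := fun s ↦ Ψ x (lieExp (s • (v : GroupLieAlgebra 𝓘(ℝ, E) G))) with hφ
  have hd : Differentiable ℝ φ := hΨ.differentiable_lieExp x _
  have hmono : Monotone (deriv φ) := hΨ.monotone_deriv x v
  have hconv : ConvexOn ℝ univ φ := hΨ.convexOn_lieExp x v
  have h0 : φ 0 = 0 := by simp [hφ, lieExp_zero, hΨ.apply_one]
  have hlim := hΨ.tendsto_maximalWeight x v.2
  constructor
  · intro hpos
    obtain ⟨s, hs0, hs⟩ := ((eventually_gt_atTop (0 : ℝ)).and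
      (hlim.eventually (lt_mem_nhds hpos))).exists
    replace hs : 0 < deriv φ s := by exact_mod_cast hs
    -- The tangent at `s` bounds `φ` from below and is eventually positive.
    have hle : ∀ t, s < t → φ s + deriv φ s * (t - s) ≤ φ t := fun t hst ↦ by
      have := hconv.deriv_le_slope (mem_univ s) (mem_univ t) hst (hd s)
      rw [slope_def_field, le_div_iff₀ (sub_pos.2 hst)] at this
      linarith
    have hq : 0 < (|φ s| + 1) / deriv φ s := by positivity
    refine ⟨s + (|φ s| + 1) / deriv φ s, by positivity, ?_⟩
    have h := hle (s + (|φ s| + 1) / deriv φ s) (lt_add_of_pos_right s hq)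
    rw [add_sub_cancel_left, mul_div_cancel₀ _ hs.ne'] at h
    change 0 < φ _
    linarith [neg_abs_le (φ s)]
  · rintro ⟨t, ht, hpos⟩
    have hslope := hconv.slope_le_deriv (mem_univ 0) (mem_univ t) ht (hd t)
    rw [slope_def_field, h0, sub_zero, sub_zero] at hslope
    have hder : 0 < deriv φ t := (div_pos hpos ht).trans_le hslope
    refine (EReal.coe_pos.2 hder).trans_le (ge_of_tendsto hlim ?_)
    filter_upwards [eventually_ge_atTop t] with s hs
    exact EReal.coe_le_coe_iff.2 (hmono hs)

theorem IsKempfNess.continuous (hΨ : IsKempfNess E θ K Ψ) (x : M) : Continuous (Ψ x) :=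
  (hΨ.smooth x).continuous

/-- Positivity of all maximal weights of `x` is properness of `Ψ x`. -/
theorem IsKempfNess.maximalWeight_pos_iff_tendsto_cocompact (hG : IsRealReductive E θ K)
    (hΨ : IsKempfNess E θ K Ψ) (x : M) :
    (∀ ξ ∈ cartanP E θ, ξ ≠ 0 → 0 < maximalWeight Ψ x ξ) ↔
      Tendsto (Ψ x) (cocompact G) atTop := by
  have := t2Space_cartanP (E := E) (θ := θ)
  have := finiteDimensional_cartanP (E := E) (θ := θ)
  constructor
  · intro h
    refine hG.tendsto_cocompact_of_lieExp (hΨ.left_invariant x) ?_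
    refine tendsto_cocompact_atTop_of_convexOn_lines
      ((hΨ.continuous x).comp hG.isClosedEmbedding_lieExp.continuous)
      (by simp [lieExp_zero, hΨ.apply_one]) (fun v ↦ hΨ.convexOn_lieExp x v) fun v hv ↦ ?_
    exact (hΨ.maximalWeight_pos_iff x v).1 (h v v.2 (by simpa using hv))
  · intro h ξ hξ hne
    refine (hΨ.maximalWeight_pos_iff x ⟨ξ, hξ⟩).2 ?_
    have hv : (⟨ξ, hξ⟩ : cartanP E θ) ≠ 0 := by simpa [Subtype.ext_iff] using hne
    exact ((eventually_gt_atTop 0).and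
      ((h.comp (hG.tendsto_lieExp_smul hv)).eventually (eventually_gt_atTop 0))).exists

/-- Properness of `Ψ x` depends only on the orbit of `x`. -/
theorem IsKempfNess.tendsto_cocompact_smul (hΨ : IsKempfNess E θ K Ψ) {x : M} (g : G)
    (h : Tendsto (Ψ x) (cocompact G) atTop) : Tendsto (Ψ (g • x)) (cocompact G) atTop := by
  have : ContinuousMul G := continuousMul_of_contMDiffMul 𝓘(ℝ, E) ∞
  have h1 := tendsto_atTop_add_const_right _ (-Ψ x g)
    (h.comp (Homeomorph.mulRight g).isClosedEmbedding.tendsto_cocompact)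
  refine h1.congr fun a ↦ ?_
  have := hΨ.cocycle x g a
  simp only [Function.comp_apply, Homeomorph.coe_mulRight]
  linarith

/-! ### Zeros of the gradient map and stabilizers -/

/-- At a zero of the gradient map, `Ψ y` is positive on `exp v` whenever `exp (ℝ v)` does not fix
`y`. -/
theorem IsKempfNess.pos_lieExp_of_gradientMap_eq_zero (hΨ : IsKempfNess E θ K Ψ) {y : M}
    (hy : gradientMap E θ Ψ y = 0) (v : cartanP E θ)
    (hv : ¬ ∀ t : ℝ, lieExp (t • (v : GroupLieAlgebra 𝓘(ℝ, E) G)) ∈ MulAction.stabilizer G y) :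
    0 < Ψ y (lieExp (v : GroupLieAlgebra 𝓘(ℝ, E) G)) := by
  set φ : ℝ → ℝ := fun s ↦ Ψ y (lieExp (s • (v : GroupLieAlgebra 𝓘(ℝ, E) G))) with hφ
  have hd : Differentiable ℝ φ := hΨ.differentiable_lieExp y _
  have hmono : Monotone (deriv φ) := hΨ.monotone_deriv y v
  have h0 : φ 0 = 0 := by simp [hφ, lieExp_zero, hΨ.apply_one]
  have hd0 : deriv φ 0 = 0 := by
    rw [(hasDerivAt_gradientMap θ Ψ y (hΨ.smooth y) v).deriv, hy]; rfl
  have hdnonneg : ∀ s, 0 ≤ s → 0 ≤ deriv φ s := fun s hs ↦ hd0 ▸ hmono hs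
  have hφmono : MonotoneOn φ (Ici 0) :=
    monotoneOn_of_deriv_nonneg (convex_Ici 0) hd.continuous.continuousOn hd.differentiableOn
      fun s hs ↦ hdnonneg s (interior_subset hs)
  have hφ1 : φ 1 = Ψ y (lieExp (v : GroupLieAlgebra 𝓘(ℝ, E) G)) := by simp [hφ]
  rw [← hφ1]
  refine lt_of_not_ge fun hle ↦ hv ((hΨ.degenerate_iff y v v.2).1 ?_)
  -- `φ` vanishes on `[0, 1]`, hence so does its derivative on `(0, 1)`, and `φ''(0) = 0` by taking
  -- the derivative of `deriv φ` at `0` from the right.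
  have hzero : ∀ s ∈ Ico (0 : ℝ) 1, φ s = 0 := fun s hs ↦ le_antisymm
    ((hφmono hs.1 (by simp) hs.2.le).trans hle) (h0 ▸ hφmono (by simp) hs.1 hs.1)
  have hderiv : ∀ s ∈ Ico (0 : ℝ) 1, deriv φ s = 0 := by
    intro s hs
    rcases hs.1.eq_or_lt with rfl | hs0
    · exact hd0
    · have : φ =ᶠ[𝓝 s] fun _ ↦ (0 : ℝ) := by
        filter_upwards [Ioo_mem_nhds hs0 hs.2] with r hr using hzero r ⟨hr.1.le, hr.2⟩
      rw [this.deriv_eq, deriv_const]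
  have hdd : HasDerivAt (deriv φ) (deriv (deriv φ) 0) 0 :=
    (differentiable_deriv_comp_lieExp (hΨ.smooth y) _ 0).hasDerivAt
  have hdd0 : HasDerivWithinAt (deriv φ) 0 (Ico 0 1) 0 :=
    (hasDerivWithinAt_const (0 : ℝ) (Ico 0 1) (0 : ℝ)).congr hderiv hd0
  have huniq : UniqueDiffWithinAt ℝ (Ico (0 : ℝ) 1) 0 := uniqueDiffOn_Ico 0 1 0 (by simp)
  simpa [iteratedDeriv_succ] using huniq.eq_deriv _ hdd.hasDerivWithinAt hdd0

/-- If `Ψ y` is proper and nonnegative, then `K` contains the stabilizer of `y`. -/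
theorem IsKempfNess.stabilizer_le (hG : IsRealReductive E θ K) (hΨ : IsKempfNess E θ K Ψ) {y : M}
    (hproper : Tendsto (Ψ y) (cocompact G) atTop) (hnonneg : ∀ g : G, 0 ≤ Ψ y g)
    (hy : gradientMap E θ Ψ y = 0) : MulAction.stabilizer G y ≤ K := by
  have hvanish : ∀ g ∈ MulAction.stabilizer G y, Ψ y g = 0 := fun g hg ↦ by
    have h := hΨ.cocycle y g g⁻¹
    rw [MulAction.mem_stabilizer_iff.1 hg, inv_mul_cancel, hΨ.apply_one] at h
    linarith [hnonneg g, hnonneg g⁻¹]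
  intro g hg
  obtain ⟨k, hk, w, rfl⟩ := hG.exists_eq_mul_lieExp g
  have hw : ∀ t : ℝ, lieExp (t • (w : GroupLieAlgebra 𝓘(ℝ, E) G)) ∈ MulAction.stabilizer G y := by
    by_contra hcon
    have hpos := hΨ.pos_lieExp_of_gradientMap_eq_zero hy w hcon
    rw [← hΨ.left_invariant y k _ hk, hvanish _ hg] at hpos
    exact hpos.false
  have hw0 : w = 0 := by
    by_contra hne
    obtain ⟨t, ht⟩ := ((hproper.comp (hG.tendsto_lieExp_smul hne)).eventually
      (eventually_gt_atTop 0)).exists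
    exact ht.ne' (hvanish _ (hw t))
  simpa [hw0, lieExp_zero] using hk

theorem gradientMap_eq_zero_of_nonneg (hΨ : IsKempfNess E θ K Ψ) {y : M}
    (hnonneg : ∀ g : G, 0 ≤ Ψ y g) : gradientMap E θ Ψ y = 0 := by
  ext v
  refine IsLocalMin.hasDerivAt_eq_zero (.of_forall fun t ↦ ?_)
    (hasDerivAt_gradientMap θ Ψ y (hΨ.smooth y) v)
  simpa [lieExp_zero, hΨ.apply_one] using hnonneg _

theorem lieExp_adjoint_mem_stabilizer {x : M} (g : G) {v : GroupLieAlgebra 𝓘(ℝ, E) G}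
    (hv : v ∈ subgroupLieAlgebra E (MulAction.stabilizer G x)) :
    adjoint E g v ∈ subgroupLieAlgebra E (MulAction.stabilizer G (g • x)) := by
  intro t
  rw [lieExp_smul_adjoint, MulAction.mem_stabilizer_iff, smul_smul, inv_mul_cancel_right, mul_smul,
    MulAction.mem_stabilizer_iff.1 (hv t)]

end

end RealReductive

theorem mainTheorem1
    {E : Type*} [NormedAddCommGroup E] [NormedSpace ℝ E] [FiniteDimensional ℝ E]
    {G : Type*} [TopologicalSpace G] [T2Space G] [ChartedSpace E G] [Group G]
    [LieGroup 𝓘(ℝ, E) ∞ G]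
    (θ : G ≃* G) (K : Subgroup G) (hG : RealReductive.IsRealReductive E θ K)
    {M : Type*} [TopologicalSpace M] [T2Space M] [MulAction G M] [ContinuousSMul G M]
    (Ψ : M → G → ℝ) (hΨ : RealReductive.IsKempfNess E θ K Ψ) (x : M) :
    RealReductive.IsStable E θ K Ψ x ↔
      ∀ ξ ∈ RealReductive.cartanP E θ, ξ ≠ 0 → 0 < RealReductive.maximalWeight Ψ x ξ := by
  rw [hΨ.maximalWeight_pos_iff_tendsto_cocompact hG]
  constructor
  · rintro ⟨⟨_, ⟨g, rfl⟩, hy⟩, a, ha⟩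
    suffices h : Tendsto (Ψ (g • x)) (cocompact G) atTop by
      simpa using hΨ.tendsto_cocompact_smul g⁻¹ h
    rw [← hΨ.maximalWeight_pos_iff_tendsto_cocompact hG]
    intro ξ hξ hne
    refine (hΨ.maximalWeight_pos_iff (g • x) ⟨ξ, hξ⟩).2 ⟨1, one_pos, ?_⟩
    rw [one_smul]
    refine hΨ.pos_lieExp_of_gradientMap_eq_zero hy ⟨ξ, hξ⟩ fun hstab ↦ hne ?_
    -- `Ad g⁻¹` takes `ξ` into the Lie algebra of the stabilizer of `x`, and `Ad a` takes that to `𝔨`.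
    have hmem := RealReductive.lieExp_adjoint_mem_stabilizer g⁻¹ hstab
    rw [inv_smul_smul] at hmem
    have hK := ha (mem_image_of_mem _ hmem)
    refine congrArg Subtype.val
      (hG.eq_zero_of_conj_lieExp_mem (v := ⟨ξ, hξ⟩) (a * g⁻¹) fun t ↦ ?_)
    have := hK t
    rw [RealReductive.lieExp_smul_adjoint, RealReductive.lieExp_smul_adjoint] at this
    simpa [mul_assoc] using this
  · intro h
    obtain ⟨g, hg⟩ := (hΨ.continuous x).exists_forall_le h
    have hnonneg : ∀ a : G, 0 ≤ Ψ (g • x) a := fun a ↦ by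
      linarith [hΨ.cocycle x g a, hg (a * g)]
    have hy := RealReductive.gradientMap_eq_zero_of_nonneg hΨ hnonneg
    refine ⟨⟨g • x, MulAction.mem_orbit x g, hy⟩, g, ?_⟩
    rintro _ ⟨v, hv, rfl⟩ t
    exact hΨ.stabilizer_le hG (hΨ.tendsto_cocompact_smul g h) hnonneg hy
      (RealReductive.lieExp_adjoint_mem_stabilizer g hv t)
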